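/- For a finite simple graph $\Gamma=(V,E)$, a matching $M\subseteq E$ is called \emph{positive} if there is a weight function $w\colon V\to\mathbb{R}$ such that, for every edge $uv\in E$, $w(u)+w(v)>0$ if and only if $uv\in M$. A \emph{positive matching decomposition} of $\Gamma$ with $p$ parts is an ordered partition $E_1,\ldots,E_p$ of $E$ (into non-empty parts) such that $E_i$ is a positive matching of $\left(V,E\setminus\bigcup_{j<i}E_j\right)$ for $i=1,\ldots,p$; the smallest $p$ for which one exists is denoted by $\mathrm{pmd}(\Gamma)$. Let $\square$ denote the Cartesian product of graphs, $C_n$ the cycle on $n$ vertices, and $Q_4=K_2\square K_2\square K_2\square K_2$ the $4$-dimensional hypercube. Then \[\mathrm{pmd}(C_3\square C_3)=\mathrm{pmd}(C_4\square C_4)=6,\] and also $\mathrm{pmd}(Q_4)=6$. In particular, no constant smaller than $6$ is an upper bound for $\mathrm{pmd}(C_m\square C_n)$ valid for all $m,n\ge 3$: if $c$ is a natural number with $\mathrm{pmd}(C_m\square C_n)\le c$ for all $m,n\geq 3$, then $c\ge 6$. -/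

import Mathlib

namespace SimpleGraph

/-- A set `M` of edges of `Γ` is a matching if distinct edges of `M` have no common vertex. -/
def IsEdgeMatching {V : Type*} (Γ : SimpleGraph V) (M : Set (Sym2 V)) : Prop :=
  M ⊆ Γ.edgeSet ∧ ∀ e ∈ M, ∀ f ∈ M, e ≠ f → ∀ v : V, ¬ (v ∈ e ∧ v ∈ f)

/-- A matching `M` of `Γ` is positive if there are real vertex weights for which the edges of `Γ`
of positive weight are exactly the edges in `M`. -/
def IsPositiveMatching {V : Type*} (Γ : SimpleGraph V) (M : Set (Sym2 V)) : Prop :=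
  Γ.IsEdgeMatching M ∧
    ∃ w : V → ℝ, ∀ u v : V, Γ.Adj u v → (0 < w u + w v ↔ s(u, v) ∈ M)

/-- A positive matching decomposition of `Γ` with `p` parts: an ordered partition of the edge set
into (non-empty, pairwise disjoint) parts such that each part is a positive matching of the graph
that is left when the edges of all earlier parts are deleted. -/
structure IsPMD {V : Type*} (Γ : SimpleGraph V) {p : ℕ} (E : Fin p → Set (Sym2 V)) : Prop where
  nonempty : ∀ i, (E i).Nonempty
  disjoint : ∀ i j, i ≠ j → Disjoint (E i) (E j)
  iUnion_eq : ⋃ i, E i = Γ.edgeSet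
  positive : ∀ i, (Γ.deleteEdges (⋃ j : Fin p, ⋃ _ : j < i, E j)).IsPositiveMatching (E i)

/-- The smallest number of parts of a positive matching decomposition of `Γ`. -/
noncomputable def pmd {V : Type*} (Γ : SimpleGraph V) : ℕ :=
  sInf {p : ℕ | ∃ E : Fin p → Set (Sym2 V), Γ.IsPMD E}

end SimpleGraph

/-!
The three graphs are regular of degree four. A decomposition into fewer than five parts can be
padded with empty parts to have five. The four edges at a vertex lie in different parts, so each
vertex is missed by exactly one part (`FiveColoring`). Hence the numbers of vertices missed by the
five parts add up to the number of vertices, and lower bounds for them lead to a contradiction.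

The bound comes from `FiveColoring.exists_pendant`: if `u` is a vertex of greatest weight among the
vertices covered by the `i`-th part, then every neighbour of `u` along an edge of a later part is
missed by the `i`-th part, since otherwise the partner of that neighbour would be heavier than `u`.
With indices starting at `0`, the `i`-th part thus misses at least `3 - i` vertices. In a bipartite
graph the same holds on each side separately.

* In `C₃ □ C₃` the first part cannot miss just three vertices, because the others would be `u`,
  its partner and an induced 4-cycle, of which the part contains two opposite edges. As nine is odd,
  each part misses an odd number of vertices, at least `5, 3, 1, 1, 1` in turn, and the sum exceeds
  nine (`FiveColoring.card_ne_nine`).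
* `C₄ □ C₄` and `Q₄` are bipartite with eight vertices on each side, and two vertices have at most two
  common neighbours. On each side the parts miss at least `4, 2, 1` vertices in turn, and the last two
  parts together at least one. The sum is eight, so equality holds. This determines the four vertices
  of one side that the first part covers: the two missed by the second part, and the two that are
  heaviest for the second part. Each of them has a neighbour along an edge of a later part that is
  covered by the first part, which is impossible for the heaviest vertex of the first part
  (`FiveColoring.false_of_bipartite`).

The decompositions into six parts are given by explicit integer weights; an edge belongs to the part
of the first weight function that is positive on it (`isPMD_firstPositivePart`).
-/

namespace SimpleGraph

open Finset

variable {V : Type*}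

/-! ### Decompositions into five parts as edge colourings -/

/-- A positive matching decomposition of `G` into at most five parts, for a graph `G` in which
every vertex lies on exactly four edges, written as an edge colouring: `color` is the index of the
part containing an edge. The four edges at a vertex `v` have different colours, so exactly one of the
colours `0, …, 4` is absent at `v`; this is `missing v`. For any other colour `i < 5`, the
vertex `mate v i` is the other end of the edge of colour `i` at `v`. -/
structure FiveColoring (G : SimpleGraph V) where
  /-- The colour of an edge. -/
  color : Sym2 V → ℕ
  /-- The colour absent at a vertex. -/
  missing : V → ℕ
  /-- The other end of the edge of a given colour. -/
  mate : V → ℕ → V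
  /-- The weights showing that the edges of a given colour form a positive matching. -/
  weight : ℕ → V → ℝ
  missing_lt : ∀ v, missing v < 5
  color_lt : ∀ {u v}, G.Adj u v → color s(u, v) < 5
  color_ne_missing : ∀ {u v}, G.Adj u v → color s(u, v) ≠ missing u
  adj_mate : ∀ {v i}, i < 5 → missing v ≠ i → G.Adj v (mate v i)
  color_mate : ∀ {v i}, i < 5 → missing v ≠ i → color s(v, mate v i) = i
  mate_color : ∀ {u v}, G.Adj u v → mate u (color s(u, v)) = v
  weight_pos : ∀ {u v i}, G.Adj u v → i ≤ color s(u, v) →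
    (0 < weight i u + weight i v ↔ color s(u, v) = i)

/-- A positive matching decomposition with at most five parts of a graph that is regular of degree
four is a `FiveColoring`. -/
theorem IsPMD.nonempty_fiveColoring [Fintype V] [DecidableEq V] {G : SimpleGraph V}
    [DecidableRel G.Adj] (hG : ∀ v, #{x | G.Adj v x} = 4) {p : ℕ} (hp : p ≤ 5)
    {E : Fin p → Set (Sym2 V)} (hE : G.IsPMD E) : Nonempty G.FiveColoring := by
  have hcol : ∀ e : Sym2 V, ∃ n : ℕ, e ∈ G.edgeSet → ∃ h : n < p, e ∈ E ⟨n, h⟩ := by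
    intro e
    by_cases he : e ∈ G.edgeSet
    · rw [← hE.iUnion_eq, Set.mem_iUnion] at he
      obtain ⟨i, hi⟩ := he
      exact ⟨i, fun _ => ⟨i.2, hi⟩⟩
    · exact ⟨0, fun h => absurd h he⟩
  choose color hcolor using hcol
  have hmem : ∀ e ∈ G.edgeSet, ∀ i : Fin p, e ∈ E i → color e = i := by
    intro e he i hi
    obtain ⟨h, h'⟩ := hcolor e he
    by_contra hne
    have : (⟨color e, h⟩ : Fin p) ≠ i := fun hh => hne (by rw [← hh])
    exact Set.disjoint_left.1 (hE.disjoint _ _ this) h' hi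
  have hlt : ∀ {u v}, G.Adj u v → color s(u, v) < 5 := fun {u v} h =>
    (hcolor s(u, v) h).1.trans_le hp
  have hinj : ∀ {u v v'}, G.Adj u v → G.Adj u v' → color s(u, v) = color s(u, v') → v = v' := by
    intro u v v' h h' hc
    obtain ⟨h1, h2⟩ := hcolor s(u, v) h
    obtain ⟨h1', h2'⟩ := hcolor s(u, v') h'
    by_contra hne
    have h3 : s(u, v') ∈ E ⟨color s(u, v), h1⟩ := by
      convert h2'
    refine (hE.positive _).1.2 _ h2 _ h3 ?_ u ⟨by simp, by simp⟩
    intro hs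
    exact hne (Sym2.congr_right.1 hs)
  have hmiss : ∀ v, ∃ m < 5, ∀ i < 5, (m ≠ i ↔ ∃ x, G.Adj v x ∧ color s(v, x) = i) := by
    intro v
    set I := ({x | G.Adj v x} : Finset V).image (fun x => color s(v, x)) with hI
    have hIs : I ⊆ range 5 := by
      intro i hi
      obtain ⟨x, hx, rfl⟩ := mem_image.1 hi
      exact mem_range.2 (hlt (mem_filter.1 hx).2)
    have hIc : #I = 4 := by
      rw [hI, card_image_of_injOn, hG v]
      intro x hx y hy hxy
      simp only [coe_filter, mem_univ, true_and, Set.mem_ofPred_eq] at hx hy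
      exact hinj hx hy hxy
    have hone : #(range 5 \ I) = 1 := by
      rw [card_sdiff_of_subset hIs, hIc, card_range]
    obtain ⟨m, hm⟩ := card_eq_one.1 hone
    have hm' : ∀ i < 5, (m ≠ i ↔ i ∈ I) := by
      intro i hi
      have : i ∈ range 5 \ I ↔ i = m := by rw [hm, mem_singleton]
      rw [mem_sdiff, mem_range] at this
      constructor
      · intro h
        by_contra h'
        exact h (this.1 ⟨hi, h'⟩).symm
      · rintro h rfl
        exact (this.2 rfl).2 h
    have hm5 : m < 5 := by
      have : m ∈ range 5 \ I := by rw [hm, mem_singleton]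
      exact mem_range.1 (mem_sdiff.1 this).1
    refine ⟨m, hm5, fun i hi => (hm' i hi).trans ?_⟩
    simp [hI]
  choose missing hm5 hm using hmiss
  have hmate : ∀ v i, ∃ x, i < 5 → missing v ≠ i → G.Adj v x ∧ color s(v, x) = i := by
    intro v i
    by_cases h : i < 5 ∧ missing v ≠ i
    · obtain ⟨x, hx⟩ := (hm v i h.1).1 h.2
      exact ⟨x, fun _ _ => hx⟩
    · exact ⟨v, fun h1 h2 => absurd ⟨h1, h2⟩ h⟩
  choose mate hmate using hmate
  have hne : ∀ {u v}, G.Adj u v → color s(u, v) ≠ missing u := fun {u v} h =>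
    ((hm u _ (hlt h)).2 ⟨v, h, rfl⟩).symm
  have hw : ∀ i : ℕ, ∃ w : V → ℝ, ∀ u v, G.Adj u v → i ≤ color s(u, v) →
      (0 < w u + w v ↔ color s(u, v) = i) := by
    intro i
    by_cases hi : i < p
    · obtain ⟨w, hw⟩ := (hE.positive ⟨i, hi⟩).2
      refine ⟨w, fun u v h hle => ?_⟩
      have hadj : (G.deleteEdges (⋃ j : Fin p, ⋃ _ : j < ⟨i, hi⟩, E j)).Adj u v := by
        rw [deleteEdges_adj]
        refine ⟨h, fun hcon => ?_⟩
        simp only [Set.mem_iUnion] at hcon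
        obtain ⟨j, hj, hj'⟩ := hcon
        have := hmem _ h j hj'
        have hji : (j : ℕ) < i := hj
        omega
      rw [hw u v hadj]
      constructor
      · exact fun hh => hmem _ h _ hh
      · intro hh
        obtain ⟨h1, h2⟩ := hcolor s(u, v) h
        convert h2
        exact hh.symm
    · refine ⟨0, fun u v h hle => ?_⟩
      exact absurd (hle.trans_lt (hcolor s(u, v) h).1) hi
  choose weight hweight using hw
  exact ⟨{ color := color, missing := missing, mate := mate, weight := weight
           missing_lt := hm5
           color_lt := hlt
           color_ne_missing := hne
           adj_mate := fun h1 h2 => (hmate _ _ h1 h2).1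
           color_mate := fun h1 h2 => (hmate _ _ h1 h2).2
           mate_color := fun {u v} h =>
            hinj (hmate _ _ (hlt h) (hne h).symm).1 h (hmate _ _ (hlt h) (hne h).symm).2
           weight_pos := fun {u v i} h hle => hweight i u v h hle }⟩

namespace FiveColoring

variable {G : SimpleGraph V} (C : G.FiveColoring)

theorem missing_mate_ne {v : V} {i : ℕ} (hi : i < 5) (hv : C.missing v ≠ i) :
    C.missing (C.mate v i) ≠ i := by
  have h := C.color_ne_missing (C.adj_mate hi hv).symm
  rw [Sym2.eq_swap, C.color_mate hi hv] at h
  exact h.symm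

theorem mate_mate {v : V} {i : ℕ} (hi : i < 5) (hv : C.missing v ≠ i) :
    C.mate (C.mate v i) i = v := by
  have h := C.mate_color (C.adj_mate hi hv).symm
  rwa [Sym2.eq_swap, C.color_mate hi hv] at h

variable [DecidableEq V]

/-- The vertices joined to `u` by an edge of colour greater than `i`. -/
def later (u : V) (i : ℕ) : Finset V :=
  ((Ioo i 5).erase (C.missing u)).image (C.mate u)

theorem mem_later {u x : V} {i : ℕ} :
    x ∈ C.later u i ↔ G.Adj u x ∧ i < C.color s(u, x) := by
  simp only [later, mem_image, mem_erase, mem_Ioo]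
  constructor
  · rintro ⟨j, ⟨h1, h2, h3⟩, rfl⟩
    exact ⟨C.adj_mate h3 h1.symm, by rwa [C.color_mate h3 h1.symm]⟩
  · rintro ⟨h1, h2⟩
    exact ⟨_, ⟨C.color_ne_missing h1, h2, C.color_lt h1⟩, C.mate_color h1⟩

theorem card_later (u : V) (i : ℕ) :
    #(C.later u i) = #((Ioo i 5).erase (C.missing u)) := by
  refine card_image_of_injOn ?_
  intro a ha b hb hab
  simp only [coe_erase, coe_Ioo, Set.mem_sdiff, Set.mem_Ioo, Set.mem_singleton_iff] at ha hb
  rw [← C.color_mate ha.1.2 (Ne.symm ha.2), ← C.color_mate hb.1.2 (Ne.symm hb.2), hab]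

theorem card_later_of_le {u : V} {i : ℕ} (h : C.missing u ≤ i) : #(C.later u i) = 4 - i := by
  rw [C.card_later, erase_eq_of_notMem (by simp [h]), Nat.card_Ioo]
  omega

theorem card_later_of_lt {u : V} {i : ℕ} (h : i < C.missing u) : #(C.later u i) = 3 - i := by
  rw [C.card_later, card_erase_of_mem (by simp [h, C.missing_lt]), Nat.card_Ioo]
  omega

theorem le_card_later (u : V) (i : ℕ) : 3 - i ≤ #(C.later u i) := by
  rcases le_or_gt (C.missing u) i with h | h
  · rw [C.card_later_of_le h]; omega
  · rw [C.card_later_of_lt h]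

theorem later_comm {u x : V} {i : ℕ} : x ∈ C.later u i ↔ u ∈ C.later x i := by
  rw [mem_later, mem_later, G.adj_comm, Sym2.eq_swap]

/-- A vertex `u` of greatest `i`-th weight in `R` works: if `x` is joined to `u` by an edge of later
colour and `y` is the mate of `x`, then `w u + w x ≤ 0 < w x + w y`, so `y` is heavier than `u`. -/
theorem exists_pendant {R : Finset V} (hR : R.Nonempty) {i : ℕ} (hi : i < 5) :
    ∃ u ∈ R, ∀ x ∈ C.later u i, C.missing x ≠ i → C.mate x i ∉ R := by
  obtain ⟨u, hu, hmax⟩ := exists_max_image R (C.weight i) hR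
  refine ⟨u, hu, fun x hx hxi hmem => ?_⟩
  obtain ⟨hadj, hlt⟩ := C.mem_later.1 hx
  have h1 : ¬ 0 < C.weight i u + C.weight i x := by
    rw [C.weight_pos hadj hlt.le]
    exact hlt.ne'
  have h2 : 0 < C.weight i x + C.weight i (C.mate x i) := by
    rw [C.weight_pos (C.adj_mate hi hxi) (C.color_mate hi hxi).ge]
    exact C.color_mate hi hxi
  linarith [hmax _ hmem]

/-! ### Nine vertices -/

variable [Fintype V]

/-- The vertices at which the colour `i` is absent. -/
def uncovered (i : ℕ) : Finset V := {v | C.missing v = i}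

omit [DecidableEq V] in
theorem mem_uncovered {i : ℕ} {v : V} : v ∈ C.uncovered i ↔ C.missing v = i := by
  simp [uncovered]

omit [DecidableEq V] in
theorem sum_card_uncovered : ∑ i ∈ range 5, #(C.uncovered i) = Fintype.card V :=
  (card_eq_sum_card_fiberwise (s := univ) fun v _ => by simp [C.missing_lt v]).symm

theorem even_card_covered {i : ℕ} (hi : i < 5) : Even #(C.uncovered i)ᶜ := by
  have h : ∑ _v ∈ (C.uncovered i)ᶜ, (1 : ZMod 2) = 0 := by
    refine sum_involution (fun v _ => C.mate v i) (fun _ _ => by decide) ?_ ?_ ?_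
    · intro v hv _ h
      rw [mem_compl, mem_uncovered] at hv
      exact (C.adj_mate hi hv).ne h.symm
    · intro v hv
      rw [mem_compl, mem_uncovered] at hv ⊢
      exact C.missing_mate_ne hi hv
    · intro v hv
      rw [mem_compl, mem_uncovered] at hv
      exact C.mate_mate hi hv
  rw [sum_const, nsmul_one] at h
  exact (ZMod.natCast_eq_zero_iff_even).1 h

theorem exists_later_subset_uncovered {i : ℕ} (hi : i < 5) (h : (C.uncovered i)ᶜ.Nonempty) :
    ∃ u, C.missing u ≠ i ∧ C.later u i ⊆ C.uncovered i := by
  obtain ⟨u, hu, hu'⟩ := C.exists_pendant h hi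
  rw [mem_compl, mem_uncovered] at hu
  refine ⟨u, hu, fun x hx => ?_⟩
  by_contra hxi
  rw [mem_uncovered] at hxi
  apply hu' x hx hxi
  rw [mem_compl, mem_uncovered]
  exact C.missing_mate_ne hi hxi

/-- If each vertex `u` of `G` has exactly four non-neighbours and these lie on an induced 4-cycle,
then more than three vertices are left uncovered by the first colour: otherwise the uncovered
vertices are neighbours of a vertex `u`, and the first colour contains two opposite edges of the
4-cycle, against the positivity of the matching. -/
theorem card_uncovered_zero_ne_three (hV : Fintype.card V = 9)
    (hcyc : ∀ u : V, ∃ a b c d : V, G.Adj a b ∧ G.Adj b c ∧ G.Adj c d ∧ G.Adj d a ∧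
      ¬ G.Adj a c ∧ ¬ G.Adj b d ∧ a ≠ c ∧ b ≠ d ∧
      ∀ x, ((x = a ∨ x = b ∨ x = c ∨ x = d) ↔ ¬ (x = u ∨ G.Adj u x))) :
    #(C.uncovered 0) ≠ 3 := by
  intro h3
  have hne : (C.uncovered 0)ᶜ.Nonempty := by
    rw [← card_pos, card_compl, hV, h3]; norm_num
  obtain ⟨u, hu, hsub⟩ := C.exists_later_subset_uncovered (by norm_num) hne
  have heq : C.later u 0 = C.uncovered 0 := by
    apply eq_of_subset_of_card_le hsub
    rw [C.card_later_of_lt (by omega), h3]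
  obtain ⟨a, b, c, d, hab, hbc, hcd, hda, hac, hbd, hacne, hbdne, hall⟩ := hcyc u
  -- The vertices of the 4-cycle are covered by the first colour, with mates on the 4-cycle.
  have key : ∀ x, (x = a ∨ x = b ∨ x = c ∨ x = d) → G.Adj x (C.mate x 0) ∧
      C.color s(x, C.mate x 0) = 0 ∧ C.mate (C.mate x 0) 0 = x ∧
      (C.mate x 0 = a ∨ C.mate x 0 = b ∨ C.mate x 0 = c ∨ C.mate x 0 = d) := by
    intro x hx
    have hxu := (hall x).1 hx
    have hx0 : C.missing x ≠ 0 := by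
      rw [Ne, ← C.mem_uncovered, ← heq, C.mem_later]
      exact fun h => hxu (Or.inr h.1)
    have hadj := C.adj_mate (by norm_num) hx0
    have hmm := C.mate_mate (by norm_num) hx0
    have hm0 := C.missing_mate_ne (by norm_num) hx0
    refine ⟨hadj, C.color_mate (by norm_num) hx0, hmm, (hall _).2 ?_⟩
    rintro (h | h)
    · exact hxu (Or.inr (h ▸ hadj.symm))
    · rcases Nat.eq_zero_or_pos (C.color s(u, C.mate x 0)) with h0 | h0
      · have h1 := C.mate_color h.symm
        rw [Sym2.eq_swap, h0, hmm] at h1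
        exact hxu (Or.inl h1)
      · have h1 := C.mem_later.2 ⟨h, h0⟩
        rw [heq, mem_uncovered] at h1
        exact hm0 h1
  have hzero : ∀ {x y}, G.Adj x y → C.mate x 0 ≠ y →
      C.weight 0 x + C.weight 0 y ≤ 0 := by
    intro x y hxy hm
    rw [← not_lt, C.weight_pos hxy (Nat.zero_le _)]
    intro h
    have := C.mate_color hxy
    rw [h] at this
    exact hm this
  have hpos : ∀ {x}, (x = a ∨ x = b ∨ x = c ∨ x = d) →
      0 < C.weight 0 x + C.weight 0 (C.mate x 0) := by
    intro x hx
    obtain ⟨h1, h2, -⟩ := key x hx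
    rw [C.weight_pos h1 (Nat.zero_le _)]
    exact h2
  obtain ⟨a1, -, a3, a4⟩ := key a (by simp)
  obtain ⟨c1, -, c3, c4⟩ := key c (by simp)
  have pa := hpos (x := a) (by simp)
  have pc := hpos (x := c) (by simp)
  have hma : C.mate a 0 = b ∨ C.mate a 0 = d := by
    rcases a4 with h | h | h | h
    · rw [h] at a1; exact absurd a1 (G.loopless.irrefl _)
    · exact Or.inl h
    · rw [h] at a1; exact absurd a1 hac
    · exact Or.inr h
  have hmc : C.mate c 0 = b ∨ C.mate c 0 = d := by
    rcases c4 with h | h | h | h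
    · rw [h] at c1; exact absurd c1.symm hac
    · exact Or.inl h
    · rw [h] at c1; exact absurd c1 (G.loopless.irrefl _)
    · exact Or.inr h
  have hmne : C.mate a 0 ≠ C.mate c 0 := fun h => hacne (by rw [← a3, ← c3, h])
  rcases hma with h | h <;> rcases hmc with h' | h'
  · exact hmne (h.trans h'.symm)
  · have e1 := hzero hda.symm (by rw [h]; exact hbdne)
    have e2 := hzero hbc.symm (by rw [h']; exact hbdne.symm)
    rw [h] at pa; rw [h'] at pc
    linarith
  · have e1 := hzero hab (by rw [h]; exact hbdne.symm)
    have e2 := hzero hcd (by rw [h']; exact hbdne)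
    rw [h] at pa; rw [h'] at pc
    linarith
  · exact hmne (h.trans h'.symm)

/-- The number of vertices missing each colour is odd, and at least `5, 3, 1, 1, 1` in turn. -/
theorem card_ne_nine (C : G.FiveColoring)
    (hcyc : ∀ u : V, ∃ a b c d : V, G.Adj a b ∧ G.Adj b c ∧ G.Adj c d ∧ G.Adj d a ∧
      ¬ G.Adj a c ∧ ¬ G.Adj b d ∧ a ≠ c ∧ b ≠ d ∧
      ∀ x, ((x = a ∨ x = b ∨ x = c ∨ x = d) ↔ ¬ (x = u ∨ G.Adj u x))) :
    Fintype.card V ≠ 9 := by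
  intro hV
  have hsum := C.sum_card_uncovered
  have hle : ∀ i < 5, 3 - i ≤ #(C.uncovered i) := by
    intro i hi
    rcases (C.uncovered i)ᶜ.eq_empty_or_nonempty with h | h
    · have := card_compl (C.uncovered i)
      rw [h, card_empty, hV] at this
      omega
    · obtain ⟨u, -, hu⟩ := C.exists_later_subset_uncovered hi h
      exact (C.le_card_later u i).trans (card_le_card hu)
  have hodd : ∀ i < 5, #(C.uncovered i) % 2 = 1 := by
    intro i hi
    have h1 := C.even_card_covered hi
    have h2 := card_compl_add_card (C.uncovered i)
    rw [hV] at h2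
    rw [Nat.even_iff] at h1
    omega
  have h3 := C.card_uncovered_zero_ne_three hV hcyc
  simp only [sum_range_succ, sum_range_zero, hV] at hsum
  have := hle 0; have := hle 1
  have := hodd 0; have := hodd 1; have := hodd 2; have := hodd 3; have := hodd 4
  omega

/-! ### Bipartite graphs with eight vertices on each side -/

/-- The vertices on the side `s` at which the colour `i` is absent. -/
def uncoveredOn (side : V → Bool) (s : Bool) (i : ℕ) : Finset V :=
  {v | side v = s ∧ C.missing v = i}

/-- The vertices on the side `s` that lie on an edge of colour `i`. -/
def coveredOn (side : V → Bool) (s : Bool) (i : ℕ) : Finset V :=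
  {v | side v = s ∧ C.missing v ≠ i}

section Bipartite

variable {side : V → Bool}

omit [DecidableEq V] in
theorem mem_uncoveredOn {s : Bool} {i : ℕ} {v : V} :
    v ∈ C.uncoveredOn side s i ↔ side v = s ∧ C.missing v = i := by
  simp [uncoveredOn]

omit [DecidableEq V] in
theorem mem_coveredOn {s : Bool} {i : ℕ} {v : V} :
    v ∈ C.coveredOn side s i ↔ side v = s ∧ C.missing v ≠ i := by
  simp [coveredOn]

omit [DecidableEq V] in
theorem card_uncoveredOn_add_card_coveredOn (s : Bool) (i : ℕ) :
    #(C.uncoveredOn side s i) + #(C.coveredOn side s i) = #{v | side v = s} := by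
  rw [← card_filter_add_card_filter_not (s := {v | side v = s}) fun v => C.missing v = i,
    filter_filter, filter_filter]
  rfl

omit [DecidableEq V] in
theorem sum_card_uncoveredOn (s : Bool) :
    ∑ i ∈ range 5, #(C.uncoveredOn side s i) = #{v | side v = s} := by
  rw [card_eq_sum_card_fiberwise (s := {v | side v = s}) (t := range 5) (f := C.missing)
    fun v _ => by simp [C.missing_lt v]]
  simp only [filter_filter]
  rfl

omit [DecidableEq V] in
theorem coveredOn_nonempty (hcard : ∀ s, #{v | side v = s} = 8) {s : Bool} {i : ℕ}
    (h : #(C.uncoveredOn side s i) < 8) :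
    (C.coveredOn side s i).Nonempty := by
  have h1 := C.card_uncoveredOn_add_card_coveredOn (side := side) s i
  rw [hcard] at h1
  rw [← card_pos]
  omega

variable (hside : ∀ u v, G.Adj u v → side v = !side u)
include hside

omit [DecidableEq V] in
theorem mate_mem_coveredOn {s : Bool} {i : ℕ} (hi : i < 5) {v : V} (hv : v ∈ C.coveredOn side s i) :
    C.mate v i ∈ C.coveredOn side (!s) i := by
  rw [mem_coveredOn] at hv ⊢
  exact ⟨by rw [hside _ _ (C.adj_mate hi hv.2), hv.1], C.missing_mate_ne hi hv.2⟩

omit [DecidableEq V] in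
theorem card_coveredOn_not (s : Bool) {i : ℕ} (hi : i < 5) :
    #(C.coveredOn side (!s) i) = #(C.coveredOn side s i) := by
  have hm : ∀ s v, v ∈ C.coveredOn side s i → C.mate (C.mate v i) i = v :=
    fun s v hv => C.mate_mate hi (C.mem_coveredOn.1 hv).2
  refine card_bij' (fun v _ => C.mate v i) (fun v _ => C.mate v i) ?_
    (fun v hv => C.mate_mem_coveredOn hside hi hv) (hm _) (hm _)
  intro v hv
  simpa using C.mate_mem_coveredOn hside hi hv

theorem later_subset_uncoveredOn {s : Bool} {u : V} (hs : side u = s) {i : ℕ}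
    (h : ∀ x ∈ C.later u i, C.missing x = i) : C.later u i ⊆ C.uncoveredOn side (!s) i := by
  intro x hx
  rw [mem_uncoveredOn]
  exact ⟨by rw [hside _ _ (C.mem_later.1 hx).1, hs], h x hx⟩

/-- `u` is a vertex of greatest `i`-th weight on the side `s`. -/
theorem exists_later_subset_uncoveredOn {s : Bool} {i : ℕ} (hi : i < 5)
    (h : (C.coveredOn side s i).Nonempty) :
    ∃ u ∈ C.coveredOn side s i, C.later u i ⊆ C.uncoveredOn side (!s) i := by
  obtain ⟨u, hu, hu'⟩ := C.exists_pendant h hi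
  refine ⟨u, hu, C.later_subset_uncoveredOn hside (C.mem_coveredOn.1 hu).1 fun x hx => ?_⟩
  by_contra hxi
  have hx' : x ∈ C.coveredOn side (!s) i :=
    C.mem_coveredOn.2
      ⟨by rw [hside _ _ (C.mem_later.1 hx).1, (C.mem_coveredOn.1 hu).1], hxi⟩
  exact hu' x hx hxi (by simpa using C.mate_mem_coveredOn hside hi hx')

/-- `u` is a vertex of greatest `i`-th weight among the vertices on the side `s` other than `u₀`. -/
theorem exists_second_pendant {s : Bool} {i : ℕ} (hi : i < 5) (u₀ : V)
    (h : ((C.coveredOn side s i).erase u₀).Nonempty) :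
    ∃ u ∈ C.coveredOn side s i, u ≠ u₀ ∧
      ∀ x ∈ C.later u i, C.missing x = i ∨ C.mate x i = u₀ := by
  obtain ⟨u, hu, hu'⟩ := C.exists_pendant h hi
  rw [mem_erase] at hu
  refine ⟨u, hu.2, hu.1, fun x hx => ?_⟩
  by_contra! hcon
  have hx' : x ∈ C.coveredOn side (!s) i :=
    C.mem_coveredOn.2
      ⟨by rw [hside _ _ (C.mem_later.1 hx).1, (C.mem_coveredOn.1 hu.2).1], hcon.1⟩
  exact hu' x hx hcon.1
    (mem_erase.2 ⟨hcon.2, by simpa using C.mate_mem_coveredOn hside hi hx'⟩)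

variable (hcard : ∀ s, #{v | side v = s} = 8)
include hcard

omit [DecidableEq V] in
theorem card_uncoveredOn_not (s : Bool) {i : ℕ} (hi : i < 5) :
    #(C.uncoveredOn side (!s) i) = #(C.uncoveredOn side s i) := by
  have h1 := C.card_uncoveredOn_add_card_coveredOn (side := side) s i
  have h2 := C.card_uncoveredOn_add_card_coveredOn (side := side) (!s) i
  have h3 := C.card_coveredOn_not hside s hi
  rw [hcard] at h1 h2
  omega

theorem le_card_uncoveredOn (s : Bool) {i : ℕ} (hi : i < 5) :
    3 - i ≤ #(C.uncoveredOn side s i) := by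
  rcases lt_or_ge #(C.uncoveredOn side s i) 8 with h | h
  · obtain ⟨u, -, hu⟩ :=
      C.exists_later_subset_uncoveredOn hside hi (C.coveredOn_nonempty hcard h)
    rw [← C.card_uncoveredOn_not hside hcard s hi]
    exact (C.le_card_later u i).trans (card_le_card hu)
  · omega

/-- The last two colours do not both cover all vertices, since their union would consist of
alternating cycles. -/
theorem one_le_card_uncoveredOn_three_add_four (s : Bool) :
    1 ≤ #(C.uncoveredOn side s 3) + #(C.uncoveredOn side s 4) := by
  by_contra! h
  have h3 : #(C.uncoveredOn side s 3) = 0 := by omega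
  have h4 : C.uncoveredOn side s 4 = ∅ := card_eq_zero.1 (by omega)
  obtain ⟨u, hu, hsub⟩ := C.exists_later_subset_uncoveredOn hside (s := s) (i := 3) (by norm_num)
    (C.coveredOn_nonempty hcard (by omega))
  have hu' := C.mem_coveredOn.1 hu
  have hu4 : C.missing u ≠ 4 := fun h => by
    have : u ∈ C.uncoveredOn side s 4 := C.mem_uncoveredOn.2 ⟨hu'.1, h⟩
    simp [h4] at this
  have hlt := C.missing_lt u
  have h1 := card_le_card hsub
  rw [C.card_uncoveredOn_not hside hcard s (by norm_num), h3,
    C.card_later_of_le (by have := hu'.2; omega)] at h1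
  omega

/-- For the second colour, a vertex `u₁` of greatest weight on the side `s` is joined by later
edges exactly to the uncovered vertices of the other side. -/
theorem exists_later_eq_uncoveredOn_one (s : Bool) (h2 : #(C.uncoveredOn side s 1) = 2) :
    ∃ u ∈ C.coveredOn side s 1, C.missing u ≠ 0 ∧
      C.later u 1 = C.uncoveredOn side (!s) 1 := by
  obtain ⟨u, hu, hsub⟩ := C.exists_later_subset_uncoveredOn hside (s := s) (i := 1) (by norm_num)
    (C.coveredOn_nonempty hcard (by omega))
  have h1 := C.card_uncoveredOn_not hside hcard s (i := 1) (by norm_num)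
  refine ⟨u, hu, fun h0 => ?_, ?_⟩
  · have := card_le_card hsub
    rw [C.card_later_of_le (by omega)] at this
    omega
  · apply eq_of_subset_of_card_le hsub
    have := C.le_card_later u 1
    omega

variable (hK : ∀ u v : V, u ≠ v → ∀ S : Finset V, (∀ x ∈ S, G.Adj u x ∧ G.Adj v x) → #S ≤ 2)
include hK

/-- If only three vertices of the other side are uncovered, then they are the neighbours, other
than the mate, of the heaviest vertex `u₁` of this side. The second heaviest vertex `u₂` has at least
two neighbours not adjacent to `u₁`; both are covered, and one of them is not the mate of `u₂`. -/
theorem card_uncoveredOn_zero_ne_three (s : Bool) : #(C.uncoveredOn side s 0) ≠ 3 := by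
  intro h3
  obtain ⟨u₁, hu₁, hsub⟩ := C.exists_later_subset_uncoveredOn hside (s := s) (i := 0) (by norm_num)
    (C.coveredOn_nonempty hcard (by omega))
  have hu₁' := C.mem_coveredOn.1 hu₁
  have heq : C.later u₁ 0 = C.uncoveredOn side (!s) 0 := by
    apply eq_of_subset_of_card_le hsub
    rw [C.card_later_of_lt (by omega), C.card_uncoveredOn_not hside hcard s (by norm_num), h3]
  have hcov := C.card_uncoveredOn_add_card_coveredOn (side := side) s 0
  rw [hcard] at hcov
  obtain ⟨u₂, hu₂, hne, hu₂'⟩ := C.exists_second_pendant hside (s := s) (i := 0) (by norm_num) u₁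
    (by rw [← card_pos, card_erase_of_mem hu₁]; omega)
  -- All later neighbours of `u₂` are neighbours of `u₁`.
  have hsub2 : ∀ x ∈ C.later u₂ 0, G.Adj u₁ x ∧ G.Adj u₂ x := by
    intro x hx
    refine ⟨?_, (C.mem_later.1 hx).1⟩
    by_cases hx0 : C.missing x = 0
    · have : x ∈ C.uncoveredOn side (!s) 0 := C.mem_uncoveredOn.2
        ⟨by rw [hside _ _ (C.mem_later.1 hx).1, (C.mem_coveredOn.1 hu₂).1], hx0⟩
      rw [← heq] at this
      exact (C.mem_later.1 this).1
    · rw [← (hu₂' x hx).resolve_left hx0]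
      exact (C.adj_mate (by norm_num) hx0).symm
  have h1 := hK _ _ hne.symm _ hsub2
  have h2 := (C.mem_coveredOn.1 hu₂).2
  rw [C.card_later_of_lt (by omega)] at h1
  omega

/-- On each side, four vertices miss the first colour and two miss the second. On one side, the four
vertices covered by the first colour are therefore the two missing the second colour and the two
heaviest vertices `u₁`, `u₂` for the second colour. Each of them has a later neighbour covered by the
first colour: the heaviest vertex `v` of the other side, or a vertex missing the second colour. -/
theorem false_of_bipartite (C : G.FiveColoring) : False := by
  have hsum : ∀ s, #(C.uncoveredOn side s 0) = 4 ∧ #(C.uncoveredOn side s 1) = 2 := by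
    intro s
    have h := C.sum_card_uncoveredOn (side := side) s
    simp only [sum_range_succ, sum_range_zero, hcard] at h
    have := C.le_card_uncoveredOn hside hcard s (i := 0)
    have := C.le_card_uncoveredOn hside hcard s (i := 1)
    have := C.le_card_uncoveredOn hside hcard s (i := 2)
    have := C.one_le_card_uncoveredOn_three_add_four hside hcard s
    have := C.card_uncoveredOn_zero_ne_three hside hcard hK s
    omega
  obtain ⟨u₁, hu₁, hu₁0, heq⟩ :=
    C.exists_later_eq_uncoveredOn_one hside hcard true (hsum _).2
  obtain ⟨v, hv, hv0, heqv⟩ :=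
    C.exists_later_eq_uncoveredOn_one hside hcard false (hsum _).2
  simp only [Bool.not_true, Bool.not_false] at heq heqv
  have hcov := C.card_uncoveredOn_add_card_coveredOn (side := side) true 1
  rw [hcard, (hsum _).2] at hcov
  obtain ⟨u₂, hu₂, hne, hu₂'⟩ := C.exists_second_pendant hside (s := true) (i := 1) (by norm_num) u₁
    (by rw [← card_pos, card_erase_of_mem hu₁]; omega)
  have hu₁m := C.mem_coveredOn.1 hu₁
  have hu₂m := C.mem_coveredOn.1 hu₂
  -- Later neighbours of `u₂` are uncovered by the second colour, or the mate of `u₁`.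
  have hx : ∀ x ∈ C.later u₂ 1, x ∈ C.later u₁ 1 ∨ (G.Adj u₁ x ∧ x = C.mate u₁ 1) := by
    intro x hx
    by_cases hx1 : C.missing x = 1
    · left
      rw [heq, mem_uncoveredOn]
      exact ⟨by rw [hside _ _ (C.mem_later.1 hx).1, hu₂m.1]; rfl, hx1⟩
    · right
      have h := (hu₂' x hx).resolve_left hx1
      rw [← h]
      exact ⟨(C.adj_mate (by norm_num) hx1).symm, (C.mate_mate (by norm_num) hx1).symm⟩
  have hu₂0 : C.missing u₂ ≠ 0 := by
    intro h0
    have h1 := hK _ _ hne.symm (C.later u₂ 1) fun x h => ⟨by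
      rcases hx x h with h | h
      · exact (C.mem_later.1 h).1
      · exact h.1, (C.mem_later.1 h).1⟩
    rw [C.card_later_of_le (by omega)] at h1
    omega
  have hu₂x : ∃ x ∈ C.later u₂ 1, x ∈ C.later u₁ 1 := by
    by_contra! hcon
    have h1 : C.later u₂ 1 ⊆ {C.mate u₁ 1} := fun x h =>
      mem_singleton.2 ((hx x h).resolve_left (hcon x h)).2
    have h2 := card_le_card h1
    have h3 := C.le_card_later u₂ 1
    rw [card_singleton] at h2
    omega
  -- The four vertices on this side covered by the first colour.
  have hfour : C.coveredOn side true 0 = insert u₁ (insert u₂ (C.uncoveredOn side true 1)) := by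
    symm
    apply eq_of_subset_of_card_le
    · intro z hz
      rw [mem_coveredOn]
      rcases mem_insert.1 hz with rfl | hz
      · exact ⟨hu₁m.1, hu₁0⟩
      rcases mem_insert.1 hz with rfl | hz
      · exact ⟨hu₂m.1, hu₂0⟩
      · rw [mem_uncoveredOn] at hz
        exact ⟨hz.1, by omega⟩
    · have h0 := C.card_uncoveredOn_add_card_coveredOn (side := side) true 0
      rw [hcard, (hsum _).1] at h0
      rw [card_insert_of_notMem, card_insert_of_notMem, (hsum _).2]
      · omega
      · rw [mem_uncoveredOn]; exact fun h => hu₂m.2 h.2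
      · rw [mem_insert, mem_uncoveredOn]
        rintro (h | h)
        · exact hne h.symm
        · exact hu₁m.2 h.2
  -- None of these four can have the greatest weight for the first colour.
  obtain ⟨z, hz, hzsub⟩ := C.exists_later_subset_uncoveredOn hside (s := true) (i := 0) (by norm_num)
    (C.coveredOn_nonempty hcard (by rw [(hsum _).1]; norm_num))
  have hcontra : ∀ x, x ∈ C.later z 1 → C.missing x ≠ 0 → False := by
    intro x hx1 hx0
    obtain ⟨h1, h2⟩ := C.mem_later.1 hx1
    have h3 := hzsub (C.mem_later.2 ⟨h1, by omega⟩)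
    exact hx0 (C.mem_uncoveredOn.1 h3).2
  have hone : ∀ x ∈ C.later u₁ 1, C.missing x ≠ 0 := by
    intro x h
    rw [heq, mem_uncoveredOn] at h
    omega
  rw [hfour] at hz
  rcases mem_insert.1 hz with rfl | hz
  · have h3 := C.le_card_later z 1
    obtain ⟨x, hx'⟩ := card_pos.1 (show 0 < #(C.later z 1) by omega)
    exact hcontra x hx' (hone x hx')
  rcases mem_insert.1 hz with rfl | hz
  · obtain ⟨x, h1, h2⟩ := hu₂x
    exact hcontra x h1 (hone x h2)
  · rw [← heqv] at hz
    exact hcontra v (C.later_comm.1 hz) hv0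

end Bipartite

end FiveColoring

/-! ### Decompositions defined by integer weights -/

/-- The edges `e = s(u, v)` of `Γ` for which `i` is the first index with `0 < w i u + w i v`. -/
def firstPositivePart (Γ : SimpleGraph V) {p : ℕ} (w : Fin p → V → ℤ) (i : Fin p) :
    Set (Sym2 V) :=
  {e | e ∈ Γ.edgeSet ∧ ∃ u v, e = s(u, v) ∧ 0 < w i u + w i v ∧
    ∀ j < i, ¬ 0 < w j u + w j v}

theorem mem_firstPositivePart {Γ : SimpleGraph V} {p : ℕ} {w : Fin p → V → ℤ} {i : Fin p}
    {u v : V} : s(u, v) ∈ Γ.firstPositivePart w i ↔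
      Γ.Adj u v ∧ 0 < w i u + w i v ∧ ∀ j < i, ¬ 0 < w j u + w j v := by
  refine and_congr_right fun _ => ⟨?_, fun h => ⟨u, v, rfl, h⟩⟩
  rintro ⟨u', v', h, h'⟩
  rcases Sym2.eq_iff.1 h with ⟨rfl, rfl⟩ | ⟨rfl, rfl⟩
  · exact h'
  · simpa only [add_comm] using h'

/-- Integer weight functions define a positive matching decomposition if every edge is positive for
one of them, every one of them is the first positive one for some edge, and the edges at a common
vertex have different first positive indices. -/
theorem isPMD_firstPositivePart (Γ : SimpleGraph V) {p : ℕ} (w : Fin p → V → ℤ)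
    (hcover : ∀ u v, Γ.Adj u v → ∃ i, 0 < w i u + w i v)
    (hnonempty : ∀ i, ∃ u v, Γ.Adj u v ∧ 0 < w i u + w i v ∧ ∀ j < i, ¬ 0 < w j u + w j v)
    (hmatching : ∀ i u v, Γ.Adj u v → (0 < w i u + w i v ∧ ∀ j < i, ¬ 0 < w j u + w j v) →
      ∀ v', Γ.Adj u v' → (0 < w i u + w i v' ∧ ∀ j < i, ¬ 0 < w j u + w j v') → v = v') :
    Γ.IsPMD (Γ.firstPositivePart w) where
  nonempty i := by
    obtain ⟨u, v, h⟩ := hnonempty i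
    exact ⟨s(u, v), mem_firstPositivePart.2 h⟩
  disjoint i j hij := by
    rw [Set.disjoint_left]
    intro e
    induction e with | _ u v
    intro hi hj
    rw [mem_firstPositivePart] at hi hj
    rcases lt_or_gt_of_ne hij with h | h
    · exact hj.2.2 _ h hi.2.1
    · exact hi.2.2 _ h hj.2.1
  iUnion_eq := by
    ext e
    induction e with | _ u v
    simp only [Set.mem_iUnion, mem_firstPositivePart, mem_edgeSet]
    constructor
    · rintro ⟨i, h, -⟩
      exact h
    · intro h
      obtain ⟨i, hi, hmin⟩ := exists_minimal_of_wellFoundedLT _ (hcover u v h)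
      exact ⟨i, h, hi, fun j hj hpos => (hmin hpos hj.le).not_gt hj⟩
  positive i := by
    have hadj : ∀ u v, (Γ.deleteEdges (⋃ j : Fin p, ⋃ _ : j < i, Γ.firstPositivePart w j)).Adj u v ↔
        Γ.Adj u v ∧ ∀ j < i, ¬ 0 < w j u + w j v := by
      intro u v
      rw [deleteEdges_adj]
      refine and_congr_right fun h => ?_
      simp only [Set.mem_iUnion, mem_firstPositivePart, not_exists, not_and]
      constructor
      · intro hno j
        induction j using WellFoundedLT.induction with
        | _ j ih =>
          intro hj hpos
          exact hno j hj h hpos fun k hk => ih k hk (hk.trans hj)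
      · exact fun hno j hj _ hpos => absurd hpos (hno j hj)
    refine ⟨⟨?_, ?_⟩, fun v => (w i v : ℝ), ?_⟩
    · intro e
      induction e with | _ u v
      rw [mem_firstPositivePart, mem_edgeSet, hadj]
      exact fun h => ⟨h.1, h.2.2⟩
    · rintro e he f hf hne x ⟨hxe, hxf⟩
      obtain ⟨y, rfl⟩ := Sym2.mem_iff_exists.1 hxe
      obtain ⟨z, rfl⟩ := Sym2.mem_iff_exists.1 hxf
      rw [mem_firstPositivePart] at he hf
      exact hne (by rw [hmatching i x y he.1 he.2 z hf.1 hf.2])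
    · intro u v h
      rw [hadj] at h
      rw [mem_firstPositivePart]
      have : 0 < (w i u : ℝ) + w i v ↔ 0 < w i u + w i v := by exact_mod_cast Iff.rfl
      rw [this]
      exact ⟨fun h' => ⟨h.1, h', h.2⟩, fun h' => h'.2.1⟩

theorem pmd_eq_of_isPMD {Γ : SimpleGraph V} {n : ℕ} {E : Fin n → Set (Sym2 V)} (hE : Γ.IsPMD E)
    (hmin : ∀ p < n, ∀ E : Fin p → Set (Sym2 V), ¬ Γ.IsPMD E) : Γ.pmd = n := by
  refine le_antisymm (Nat.sInf_le ⟨E, hE⟩) ?_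
  by_contra! h
  obtain ⟨E', hE'⟩ := Nat.sInf_mem (s := {p : ℕ | ∃ E : Fin p → Set (Sym2 V), Γ.IsPMD E}) ⟨n, E, hE⟩
  exact hmin _ h E' hE'

/-! ### The three graphs -/

/-- Adjacency in a Cartesian product of finite graphs is decidable. -/
instance decidableRelBoxProdAdj {α β : Type*} [DecidableEq α] [DecidableEq β] (G : SimpleGraph α)
    (H : SimpleGraph β) [DecidableRel G.Adj] [DecidableRel H.Adj] :
    DecidableRel (G □ H).Adj :=
  fun _ _ => decidable_of_iff' _ boxProd_adj

/-- Weights giving a positive matching decomposition of `C₃ □ C₃` into six parts. -/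
def weightsThree : Fin 6 → Fin 3 × Fin 3 → ℤ := fun i v =>
  (![
    ![![-2, 2, -3], ![-3, -1, -3], ![3, -3, -3]],
    ![![4, -3, -4], ![-4, 3, -4], ![-1, -2, 2]],
    ![![-4, -4, 3], ![-1, 2, -2], ![-3, 4, -4]],
    ![![3, -1, -2], ![-4, -5, 4], ![5, 2, -3]],
    ![![-4, -1, 2], ![-3, -4, 4], ![-4, 3, -2]],
    ![![-1, -4, 4], ![2, 3, -2], ![-4, -4, -3]]] :
      Fin 6 → Fin 3 → Fin 3 → ℤ) i v.1 v.2

theorem pmd_cycleGraph_three_boxProd : (cycleGraph 3 □ cycleGraph 3).pmd = 6 := by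
  refine pmd_eq_of_isPMD (isPMD_firstPositivePart _ weightsThree ?_ ?_ ?_) ?_
  · decide +kernel
  · decide +kernel
  · decide +kernel
  · intro p hp E hE
    obtain ⟨C⟩ := hE.nonempty_fiveColoring (by decide +kernel) (by omega)
    refine C.card_ne_nine ?_ (by decide)
    -- The non-neighbours of `u` are the vertices with both coordinates different from those of `u`.
    intro u
    refine ⟨u + (1, 1), u + (1, 2), u + (2, 2), u + (2, 1), ?_⟩
    revert u
    decide +kernel

/-- Weights giving a positive matching decomposition of `C₄ □ C₄` into six parts. -/
def weightsFour : Fin 6 → Fin 4 × Fin 4 → ℤ := fun i v =>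
  (![
    ![![-5, -5, -2, 3], ![-1, -5, -5, -5], ![2, -5, 4, -3], ![-5, 5, -4, -5]],
    ![![-3, 2, -6, -6], ![4, -4, 5, -6], ![6, -5, -6, -6], ![-6, -1, -2, 3]],
    ![![-7, 7, -6, 4], ![5, -7, 3, -4], ![6, -1, -2, -7], ![-5, 2, -7, -3]],
    ![![-5, 6, 5, -2], ![8, -7, -4, 3], ![7, 2, -1, -6], ![-3, -8, -8, 4]],
    ![![-1, 5, -3, 2], ![-7, -4, 3, -2], ![-7, -7, -7, -6], ![-5, 6, 4, 7]],
    ![![-1, -5, -5, -5], ![-5, 5, -5, -2], ![-5, -4, -3, 3], ![2, -5, 4, -5]]] :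
      Fin 6 → Fin 4 → Fin 4 → ℤ) i v.1 v.2

theorem pmd_cycleGraph_four_boxProd : (cycleGraph 4 □ cycleGraph 4).pmd = 6 := by
  refine pmd_eq_of_isPMD (isPMD_firstPositivePart _ weightsFour ?_ ?_ ?_) ?_
  · decide +kernel
  · decide +kernel
  · decide +kernel
  · intro p hp E hE
    obtain ⟨C⟩ := hE.nonempty_fiveColoring (by decide +kernel) (by omega)
    refine C.false_of_bipartite (side := fun v => decide ((v.1.val + v.2.val) % 2 = 0)) ?_ ?_ ?_
    · decide +kernel
    · decide +kernel
    · have h : ∀ u v : Fin 4 × Fin 4, u ≠ v →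
          #{x | (cycleGraph 4 □ cycleGraph 4).Adj u x ∧
            (cycleGraph 4 □ cycleGraph 4).Adj v x} ≤ 2 := by
        decide +kernel
      exact fun u v huv S hS =>
        (card_le_card fun x hx => by simpa using hS x hx).trans (h u v huv)

/-- The four-dimensional hypercube, as an iterated product of complete graphs. -/
def hypercubeFour : SimpleGraph (((Fin 2 × Fin 2) × Fin 2) × Fin 2) :=
  ((completeGraph (Fin 2) □ completeGraph (Fin 2)) □ completeGraph (Fin 2)) □
    completeGraph (Fin 2)

instance : DecidableRel hypercubeFour.Adj :=
  inferInstanceAs (DecidableRel (((completeGraph (Fin 2) □ completeGraph (Fin 2)) □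
    completeGraph (Fin 2)) □ completeGraph (Fin 2)).Adj)

/-- Weights giving a positive matching decomposition of the hypercube `Q₄` into six parts. -/
def weightsCube : Fin 6 → ((Fin 2 × Fin 2) × Fin 2) × Fin 2 → ℤ := fun i v =>
  (![
    ![![![![-2, -5], ![3, -5]], ![![-1, 2], ![-5, -4]]],
      ![![![-3, 4], ![-5, -5]], ![![-5, -5], ![-5, 5]]]],
    ![![![![-1, 2], ![-3, -6]], ![![-4, -6], ![3, -2]]],
      ![![![-6, -6], ![4, -6]], ![![5, -5], ![-6, 6]]]],
    ![![![![-6, -6], ![-6, 5]], ![![6, 2], ![-5, -6]]],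
      ![![![4, -6], ![-3, -4]], ![![-6, -1], ![3, -2]]]],
    ![![![![-6, -2], ![4, -4]], ![![7, -8], ![-3, 5]]],
      ![![![-1, 3], ![6, -7]], ![![2, -8], ![-5, 8]]]],
    ![![![![-3, 5], ![7, -6]], ![![-7, -4], ![6, -7]]],
      ![![![4, -2], ![-7, 3]], ![![2, -1], ![-5, -7]]]],
    ![![![![-6, 3], ![-6, -2]], ![![-6, 2], ![-6, -1]]],
      ![![![-6, -4], ![-3, 4]], ![![-5, 5], ![6, -6]]]]] :
      Fin 6 → Fin 2 → Fin 2 → Fin 2 → Fin 2 → ℤ) i v.1.1.1 v.1.1.2 v.1.2 v.2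

-- The instance deciding the matching condition quantifies over three vertices of a fourfold product.
set_option synthInstance.maxSize 512 in
theorem pmd_hypercube_four : hypercubeFour.pmd = 6 := by
  refine pmd_eq_of_isPMD (isPMD_firstPositivePart _ weightsCube ?_ ?_ ?_) ?_
  · decide +kernel
  · decide +kernel
  · decide +kernel
  · intro p hp E hE
    obtain ⟨C⟩ := hE.nonempty_fiveColoring (by decide +kernel) (by omega)
    refine C.false_of_bipartite
      (side := fun v => decide ((v.1.1.1.val + v.1.1.2.val + v.1.2.val + v.2.val) % 2 = 0)) ?_ ?_ ?_
    · decide +kernel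
    · decide +kernel
    · have h : ∀ u v : ((Fin 2 × Fin 2) × Fin 2) × Fin 2, u ≠ v →
          #{x | hypercubeFour.Adj u x ∧ hypercubeFour.Adj v x} ≤ 2 := by
        decide +kernel
      exact fun u v huv S hS =>
        (card_le_card fun x hx => by simpa using hS x hx).trans (h u v huv)

end SimpleGraph

theorem mainTheorem2 :
    (SimpleGraph.cycleGraph 3 □ SimpleGraph.cycleGraph 3).pmd = 6 ∧
    (SimpleGraph.cycleGraph 4 □ SimpleGraph.cycleGraph 4).pmd = 6 ∧
    (((SimpleGraph.completeGraph (Fin 2) □ SimpleGraph.completeGraph (Fin 2)) □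
      SimpleGraph.completeGraph (Fin 2)) □ SimpleGraph.completeGraph (Fin 2)).pmd = 6 ∧
    (∀ c : ℕ, (∀ m n : ℕ, 3 ≤ m → 3 ≤ n →
      (SimpleGraph.cycleGraph m □ SimpleGraph.cycleGraph n).pmd ≤ c) → 6 ≤ c) := by
  refine ⟨SimpleGraph.pmd_cycleGraph_three_boxProd, SimpleGraph.pmd_cycleGraph_four_boxProd,
    SimpleGraph.pmd_hypercube_four, fun c hc => ?_⟩
  rw [← SimpleGraph.pmd_cycleGraph_three_boxProd]
  exact hc 3 3 le_rfl le_rfl
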